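/- Let $d\ge 2$ and $1\le r\le d^2$ be integers and let $0<\epsilon<1/4$. Let $\{|i\otimes j\rangle\}_{1\le i,j\le d}$ be the canonical orthonormal basis of $\mathbb C^d\otimes\mathbb C^d$, ordered lexicographically, and let $v_1,\dots,v_r\in\mathbb C^d\otimes\mathbb C^d$ be a fixed orthonormal family of vectors with real coefficients in this basis. Let $O$ be a random $d^2\times d^2$ real orthogonal matrix distributed according to the normalized Haar measure on the orthogonal group $O(d^2)$ and, for $1\le i\le r$, let $\phi_i\in\mathbb C^d\otimes\mathbb C^d$ be the vector whose coefficients in the canonical basis form the $i$-th column of $O$. Then $$ \mathbb P\Bigl(\max_{1\le i\le r}\|\phi_i-v_i\|<\epsilon\Bigr)>(2d\sqrt{\pi})^{-r}\left(\frac{\epsilon/8}{4^r\sqrt{r!}}\right)^{rd^2-\binom{r+1}{2}}. $$ -/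

import Mathlib

open scoped TensorProduct

/-- The two-qudit space `ℂ^d ⊗ ℂ^d`, with the Hilbert space structure of the tensor product. -/
abbrev TwoQudit (d : ℕ) : Type :=
  EuclideanSpace ℂ (Fin d) ⊗[ℂ] EuclideanSpace ℂ (Fin d)

/-- The canonical orthonormal basis `|i ⊗ j⟩ = |i⟩ ⊗ |j⟩` of `ℂ^d ⊗ ℂ^d`. -/
noncomputable def canonicalBasis (d : ℕ) :
    OrthonormalBasis (Fin d × Fin d) ℂ (TwoQudit d) :=
  (EuclideanSpace.basisFun (Fin d) ℂ).tensorProduct (EuclideanSpace.basisFun (Fin d) ℂ)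

/-- The vector `x` has real coefficients in the canonical basis. -/
def HasRealCoefficients {d : ℕ} (x : TwoQudit d) : Prop :=
  ∀ p : Fin d × Fin d, ((canonicalBasis d).repr x p).im = 0

/-- The orthogonal group is compact: it is closed and its entries are bounded by `1`. -/
instance orthogonalGroup_compactSpace (n : ℕ) :
    CompactSpace (Matrix.orthogonalGroup (Fin n) ℝ) := by
  refine (isCompact_iff_compactSpace
    (s := (Matrix.orthogonalGroup (Fin n) ℝ : Set (Matrix (Fin n) (Fin n) ℝ)))).mp ?_
  have hK : IsCompact (Set.pi Set.univ fun _ : Fin n =>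
      Set.pi Set.univ fun _ : Fin n => Set.Icc (-1 : ℝ) 1) :=
    isCompact_univ_pi fun _ => isCompact_univ_pi fun _ => isCompact_Icc
  refine IsCompact.of_isClosed_subset (s := (show Set (Matrix (Fin n) (Fin n) ℝ) from
    Set.pi Set.univ fun _ => Set.pi Set.univ fun _ => Set.Icc (-1 : ℝ) 1)) hK ?_ ?_
  · have h : (Matrix.orthogonalGroup (Fin n) ℝ : Set (Matrix (Fin n) (Fin n) ℝ)) =
        {A | A * A.transpose = 1} := by
      ext A
      exact Matrix.mem_orthogonalGroup_iff (Fin n) ℝ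
    rw [h]
    exact isClosed_eq (by fun_prop) continuous_const
  · intro A hA i _ j _
    have h := entry_norm_bound_of_unitary (𝕜 := ℝ) hA i j
    rw [Real.norm_eq_abs] at h
    exact abs_le.mp h

/-- The orthogonal group carries its Borel σ-algebra. -/
instance orthogonalGroup_measurableSpace (n : ℕ) :
    MeasurableSpace (Matrix.orthogonalGroup (Fin n) ℝ) := borel _

instance orthogonalGroup_borelSpace (n : ℕ) :
    BorelSpace (Matrix.orthogonalGroup (Fin n) ℝ) := ⟨rfl⟩

/-- The Haar measure on the orthogonal group `O(n)`, normalized to total mass `1`. -/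
noncomputable def orthogonalHaar (n : ℕ) :
    MeasureTheory.Measure (Matrix.orthogonalGroup (Fin n) ℝ) :=
  MeasureTheory.Measure.haarMeasure ⊤

/-- The vectors `φ_1, …, φ_r` of `ℂ^d ⊗ ℂ^d` obtained from a `d² × d²` orthogonal matrix `O`:
the coefficients of `φ_i` in the canonical basis, ordered lexicographically, form the `i`-th
column of `O`. (`finProdFinEquiv (a, b) = b + d * a` is the lexicographic enumeration.) -/
noncomputable def columnFamily {d r : ℕ} (hr : r ≤ d * d)
    (O : Matrix.orthogonalGroup (Fin (d * d)) ℝ) (i : Fin r) : TwoQudit d :=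
  ∑ p : Fin d × Fin d,
    (((O : Matrix (Fin (d * d)) (Fin (d * d)) ℝ) (finProdFinEquiv p) (Fin.castLE hr i) : ℝ) : ℂ) •
      canonicalBasis d p

/-! Put `n = d * d`. The orthogonal group acts transitively on orthonormal `r`-frames and Haar
measure is left-invariant, so the event that the first `r` columns lie within `ε` of a frame has the
same probability for every frame. If `N` such events cover the group, each has probability at least
`1/N`. Such a cover comes from a frame net (`exists_orthonormal_net`), built by induction:
approximate the first vector on the sphere, carry the others into its orthogonal complement by a
reflection, and recurse. The exponents `n - 1 - i` add up to the dimension of the Stiefel manifold,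
which is the exponent in the theorem. The resulting bound `2⁻ʳ (ε / 6r) ^ e` exceeds the stated one.
-/

/-! ### Nets of spheres and of orthonormal frames -/

section Nets

open MeasureTheory Metric Module

variable {E : Type*} [NormedAddCommGroup E] [InnerProductSpace ℝ E]

/-- The volume of a shell around the unit sphere bounds the size of a separated set. -/
theorem card_le_of_separated_unit_vectors [FiniteDimensional ℝ E] {m : ℕ}
    (hE : finrank ℝ E = m + 1) {δ : ℝ} (hδ : 0 < δ) (hδ1 : δ ≤ 1) (S : Finset E)
    (hS : ∀ x ∈ S, ‖x‖ = 1) (hsep : (S : Set E).Pairwise fun x y => δ ≤ dist x y) :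
    (S.card : ℝ) ≤ 2 * (6 / δ) ^ m := by
  borelize E
  have : Nontrivial E := nontrivial_of_finrank_pos (R := ℝ) (by omega)
  let μ : Measure E := volume
  have hball : ∀ (x : E) {t : ℝ}, 0 ≤ t → μ.real (ball x t) = t ^ (m + 1) * μ.real (ball 0 1) := by
    intro x t ht
    rw [measureReal_def, Measure.addHaar_ball μ x ht, ENNReal.toReal_mul, hE,
      ENNReal.toReal_ofReal (by positivity), measureReal_def]
  have hpos : 0 < μ.real (ball (0 : E) 1) :=
    ENNReal.toReal_pos (measure_ball_pos μ _ one_pos).ne' measure_ball_lt_top.ne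
  have hdisj : (S : Set E).PairwiseDisjoint fun x => ball x (δ / 2) := by
    intro x hx y hy hxy
    exact ball_disjoint_ball (by linarith [hsep hx hy hxy])
  -- Removing the inner ball is what lowers the exponent from `m + 1` to `m`: the shell has volume
  -- of order `δ`.
  have hsub : (⋃ x ∈ S, ball x (δ / 2)) ⊆ ball (0 : E) (1 + δ / 2) \ ball 0 (1 - δ / 2) := by
    intro z hz
    simp only [Set.mem_iUnion, mem_ball, exists_prop] at hz
    obtain ⟨x, hx, hzx⟩ := hz
    rw [dist_eq_norm] at hzx
    have h := abs_le.mp (abs_norm_sub_norm_le z x)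
    rw [hS x hx] at h
    simp only [Set.mem_sdiff, mem_ball, dist_zero_right, not_lt]
    constructor <;> linarith
  have hvol : (S.card : ℝ) * (δ / 2) ^ (m + 1) ≤ (1 + δ / 2) ^ (m + 1) - (1 - δ / 2) ^ (m + 1) := by
    have h1 := measureReal_mono (μ := μ) hsub
      (measure_ne_top_of_subset Set.sdiff_subset measure_ball_lt_top.ne)
    rw [measureReal_biUnion_finset hdisj (fun _ _ => measurableSet_ball)
      (fun _ _ => measure_ball_lt_top.ne),
      measureReal_sdiff (ball_subset_ball (by linarith)) measurableSet_ball
        measure_ball_lt_top.ne, hball 0 (by linarith : 0 ≤ 1 + δ / 2),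
      hball 0 (by linarith : 0 ≤ 1 - δ / 2), Finset.sum_congr rfl fun x _ => hball x (by linarith : 0 ≤ δ / 2)] at h1
    rw [Finset.sum_const, nsmul_eq_mul, ← mul_assoc, ← sub_mul] at h1
    exact le_of_mul_le_mul_right h1 hpos
  have hdiff : (1 + δ / 2) ^ (m + 1) - (1 - δ / 2) ^ (m + 1) ≤ δ * (m + 1) * (1 + δ / 2) ^ m := by
    have h := abs_pow_sub_pow_le (1 + δ / 2) (1 - δ / 2) (m + 1)
    rw [abs_of_pos (a := 1 + δ / 2) (by linarith), abs_of_pos (a := 1 - δ / 2) (by linarith),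
      max_eq_left (by linarith), show 1 + δ / 2 - (1 - δ / 2) = δ by ring, abs_of_pos hδ] at h
    simpa using (le_abs_self _).trans h
  have htwo : ((m : ℝ) + 1) ≤ 2 ^ m := by exact_mod_cast Nat.lt_two_pow_self (n := m)
  have hle : (m + 1) * (1 + δ / 2) ^ m ≤ (6 / δ) ^ m * (δ / 2) ^ m := by
    calc ((m : ℝ) + 1) * (1 + δ / 2) ^ m ≤ 2 ^ m * (3 / 2) ^ m := by gcongr; linarith
      _ = (6 / δ) ^ m * (δ / 2) ^ m := by
        rw [← mul_pow, ← mul_pow]; congr 1; field_simp; norm_num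
  refine le_of_mul_le_mul_right ?_ (by positivity : 0 < (δ / 2) ^ (m + 1))
  calc (S.card : ℝ) * (δ / 2) ^ (m + 1) ≤ δ * ((m + 1) * (1 + δ / 2) ^ m) := by
        rw [← mul_assoc]; exact hvol.trans hdiff
    _ ≤ δ * ((6 / δ) ^ m * (δ / 2) ^ m) := by gcongr
    _ = 2 * (6 / δ) ^ m * (δ / 2) ^ (m + 1) := by ring

/-- The unit sphere of an `(m + 1)`-dimensional Euclidean space has a net of size `O(δ⁻¹) ^ m`. -/
theorem exists_unit_sphere_net [FiniteDimensional ℝ E] {m : ℕ}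
    (hE : finrank ℝ E = m + 1) {δ : ℝ} (hδ : 0 < δ) (hδ1 : δ ≤ 1) :
    ∃ S : Finset E, (∀ x ∈ S, ‖x‖ = 1) ∧ (S.card : ℝ) ≤ 2 * (6 / δ) ^ m ∧
      ∀ y : E, ‖y‖ = 1 → ∃ x ∈ S, ‖y - x‖ < δ := by
  classical
  -- A separated set of maximal cardinality is a net, since a point far from it could be added.
  let P : ℕ → Prop := fun k => ∃ S : Finset E, S.card = k ∧ (∀ x ∈ S, ‖x‖ = 1) ∧
    (S : Set E).Pairwise fun x y => δ ≤ dist x y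
  have hbound : ∀ k, P k → k ≤ ⌊2 * (6 / δ) ^ m⌋₊ := by
    rintro k ⟨S, rfl, hS, hsep⟩
    exact Nat.le_floor (card_le_of_separated_unit_vectors hE hδ hδ1 S hS hsep)
  have hP0 : P 0 := ⟨∅, by simp⟩
  obtain ⟨S, hcard, hS, hsep⟩ := Nat.findGreatest_spec (Nat.zero_le ⌊2 * (6 / δ) ^ m⌋₊) hP0
  refine ⟨S, hS, card_le_of_separated_unit_vectors hE hδ hδ1 S hS hsep, fun y hy => ?_⟩
  by_contra! hfar
  have hyS : y ∉ S := fun h => by simpa using (hfar y h).trans_lt' hδ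
  have hP : P (S.card + 1) := by
    refine ⟨insert y S, Finset.card_insert_of_notMem hyS, by simpa [hy] using hS, ?_⟩
    rw [Finset.coe_insert, Set.pairwise_insert]
    refine ⟨hsep, fun x hx _ => ?_⟩
    rw [dist_comm x y, and_self, dist_eq_norm]
    exact hfar x hx
  have := Nat.le_findGreatest (hbound _ hP) hP
  omega

/-- A unit vector `x` near a unit vector `o` is reached by a reflection up to sign, and the
reflection moves the vectors orthogonal to `o` by no more than `‖o - x‖`. -/
theorem norm_reflection_sub_le {o x z : E} (ho : ‖o‖ = 1) (hx : ‖x‖ = 1) (hz : ‖z‖ = 1)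
    (hoz : inner ℝ o z = 0) :
    ‖z - (ℝ ∙ (o + x))ᗮ.reflection z‖ ≤ ‖o - x‖ := by
  -- As `z ⟂ o`, only the part of `x` orthogonal to `o` matters; its norm is `‖o + x‖ * ‖o - x‖ /
  -- 2`.
  have hinner : inner ℝ (o + x) z = inner ℝ (x - inner ℝ o x • o) z := by
    simp [inner_add_left, inner_sub_left, inner_smul_left, hoz]
  have hs : ‖o + x‖ ^ 2 = 2 + 2 * inner ℝ o x := by
    rw [norm_add_sq_real, ho, hx]; ring
  have ht : ‖o - x‖ ^ 2 = 2 - 2 * inner ℝ o x := by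
    rw [norm_sub_sq_real, ho, hx]; ring
  have hw : ‖x - inner ℝ o x • o‖ ^ 2 = 1 - inner ℝ o x ^ 2 := by
    rw [norm_sub_sq_real, norm_smul, ho, hx, inner_smul_right, real_inner_comm, mul_one,
      Real.norm_eq_abs, sq_abs]
    ring
  have hle : |inner ℝ (o + x) z| ≤ ‖o + x‖ * ‖o - x‖ / 2 := by
    refine abs_le_of_sq_le_sq ?_ (by positivity)
    have h1 : |inner ℝ (o + x) z| ≤ ‖x - inner ℝ o x • o‖ := by
      rw [hinner]; simpa [hz] using abs_real_inner_le_norm (x - inner ℝ o x • o) z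
    have h2 := pow_le_pow_left₀ (abs_nonneg _) h1 2
    rw [sq_abs, hw] at h2
    rw [div_pow, mul_pow, hs, ht]
    linarith
  rw [Submodule.reflection_orthogonal_apply, Submodule.reflection_singleton_apply, neg_sub,
    sub_sub_cancel]
  simp only [RCLike.ofReal_real_eq_id, id_eq, two_smul]
  rcases eq_or_ne (o + x) 0 with h0 | h0
  · simp [h0]
  have hn : 0 < ‖o + x‖ := norm_pos_iff.mpr h0
  rw [← add_smul, norm_smul, Real.norm_eq_abs, ← two_mul, abs_mul, abs_div, abs_two,
    abs_of_pos (pow_pos hn 2)]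
  calc 2 * (|inner ℝ (o + x) z| / ‖o + x‖ ^ 2) * ‖o + x‖
      = 2 * |inner ℝ (o + x) z| / ‖o + x‖ := by field_simp
    _ ≤ ‖o - x‖ := by rw [div_le_iff₀ hn]; linarith

/-- The sign is harmless: vectors orthogonal to `o` still land in the complement of `x`. -/
theorem reflection_add_eq_neg {o x : E} (ho : ‖o‖ = 1) (hx : ‖x‖ = 1) :
    (ℝ ∙ (o + x))ᗮ.reflection o = -x := by
  have h := Submodule.reflection_sub (v := o) (w := -x) (by rw [norm_neg, ho, hx])
  simpa using h

theorem orthonormal_cons_orthogonal {x : E} (hx : ‖x‖ = 1) {r : ℕ} {t : Fin r → (ℝ ∙ x)ᗮ}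
    (ht : Orthonormal ℝ t) :
    Orthonormal ℝ (Fin.cons x fun i => (t i : E) : Fin (r + 1) → E) := by
  constructor
  · intro i
    refine Fin.cases ?_ (fun i => ?_) i
    · simpa using hx
    · simpa using ht.1 i
  · intro i j
    refine Fin.cases ?_ (fun i => ?_) i <;> refine Fin.cases ?_ (fun j => ?_) j
    · simp
    · intro _
      simpa using Submodule.mem_orthogonal_singleton_iff_inner_right.mp (t j).2
    · intro _
      simpa using Submodule.mem_orthogonal_singleton_iff_inner_left.mp (t i).2
    · intro h
      simpa using ht.2 (fun hij => h (congrArg Fin.succ hij))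

/-- The orthonormal `r`-frames of an `n`-dimensional Euclidean space have a net whose size is
governed by the dimension of the Stiefel manifold. -/
theorem exists_orthonormal_net {δ : ℝ} (hδ : 0 < δ) (hδ1 : δ ≤ 1) (r : ℕ) :
    ∀ {E : Type*} [NormedAddCommGroup E] [InnerProductSpace ℝ E] [FiniteDimensional ℝ E] {n : ℕ},
      finrank ℝ E = n → r ≤ n →
    ∃ T : Finset (Fin r → E), (∀ t ∈ T, Orthonormal ℝ t) ∧
      (T.card : ℝ) ≤ ∏ i ∈ Finset.range r, 2 * (6 / δ) ^ (n - 1 - i) ∧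
      ∀ o : Fin r → E, Orthonormal ℝ o → ∃ t ∈ T, ∀ i, ‖o i - t i‖ < r * δ := by
  classical
  induction r with
  | zero =>
    intro E _ _ _ n _ _
    exact ⟨{finZeroElim}, by simp [Orthonormal, Pairwise], by simp,
      fun o _ => ⟨finZeroElim, by simp, fun i => i.elim0⟩⟩
  | succ r ih =>
    intro E _ _ _ n hn hrn
    obtain ⟨m, rfl⟩ : ∃ m, n = m + 1 := ⟨n - 1, by omega⟩
    obtain ⟨S, hS1, hScard, hSnet⟩ := exists_unit_sphere_net hn hδ hδ1
    have : Fact (finrank ℝ E = m + 1) := ⟨hn⟩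
    have hdim : ∀ x : S, finrank ℝ (ℝ ∙ (x : E))ᗮ = m := fun x =>
      Submodule.finrank_orthogonal_span_singleton (by
        rw [← norm_pos_iff, hS1 x x.2]; exact one_pos)
    choose T hT1 hTcard hTnet using fun x : S => ih (E := (ℝ ∙ (x : E))ᗮ) (hdim x) (by omega)
    refine ⟨S.attach.biUnion fun x => (T x).image fun t => Fin.cons (x : E) fun i => (t i : E),
      ?_, ?_, ?_⟩
    · intro t ht
      simp only [Finset.mem_biUnion, Finset.mem_image] at ht
      obtain ⟨x, _, s, hs, rfl⟩ := ht
      exact orthonormal_cons_orthogonal (hS1 x x.2) (hT1 x s hs)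
    · rw [Finset.prod_range_succ']
      set C := ∏ i ∈ Finset.range r, 2 * (6 / δ) ^ (m - 1 - i) with hC
      have hC0 : 0 ≤ C := Finset.prod_nonneg fun i _ => by positivity
      have hshift : ∏ k ∈ Finset.range r, 2 * (6 / δ) ^ (m + 1 - 1 - (k + 1)) = C :=
        Finset.prod_congr rfl fun i _ => by congr 2; omega
      rw [hshift]
      calc ((S.attach.biUnion fun x => (T x).image _).card : ℝ)
          ≤ ∑ x ∈ S.attach, (((T x).image fun t =>
              (Fin.cons (x : E) fun i => (t i : E) : Fin (r + 1) → E)).card : ℝ) := by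
            exact_mod_cast Finset.card_biUnion_le
        _ ≤ ∑ x ∈ S.attach, C := Finset.sum_le_sum fun x _ =>
            (Nat.cast_le.mpr Finset.card_image_le).trans (hTcard x)
        _ = S.card * C := by simp
        _ ≤ 2 * (6 / δ) ^ m * C := by gcongr
        _ = C * (2 * (6 / δ) ^ (m + 1 - 1 - 0)) := by simp [mul_comm]
    · intro o ho
      obtain ⟨x, hxS, hx⟩ := hSnet (o 0) (ho.1 0)
      have hx1 := hS1 x hxS
      let R := (ℝ ∙ (o 0 + x))ᗮ.reflection
      have hmem : ∀ i : Fin r, R (o i.succ) ∈ (ℝ ∙ x)ᗮ := by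
        intro i
        rw [Submodule.mem_orthogonal_singleton_iff_inner_right, ← neg_eq_zero, ← inner_neg_left,
          ← reflection_add_eq_neg (ho.1 0) hx1, LinearIsometryEquiv.inner_map_map]
        exact ho.2 (Fin.succ_ne_zero i).symm
      have horth : Orthonormal ℝ fun i : Fin r => (⟨R (o i.succ), hmem i⟩ : (ℝ ∙ x)ᗮ) := by
        constructor
        · intro i
          simpa using ho.1 i.succ
        · intro i j hij
          simpa using ho.2 (fun h => hij (Fin.succ_injective _ h))
      obtain ⟨t, ht, hnear⟩ := hTnet ⟨x, hxS⟩ _ horth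
      refine ⟨Fin.cons x fun i => (t i : E), ?_, ?_⟩
      · exact Finset.mem_biUnion.mpr ⟨⟨x, hxS⟩, Finset.mem_attach _ _,
          Finset.mem_image.mpr ⟨t, ht, rfl⟩⟩
      · intro i
        push_cast
        refine Fin.cases ?_ (fun i => ?_) i
        -- The first vector has error below `δ`; each later one adds one reflection error to the
        -- inductive `r * δ`.
        · rw [Fin.cons_zero]
          nlinarith [(Nat.cast_nonneg r : (0 : ℝ) ≤ r)]
        · rw [Fin.cons_succ]
          have h1 := norm_reflection_sub_le (ho.1 0) hx1 (ho.1 i.succ)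
            (ho.2 (Fin.succ_ne_zero i).symm)
          have h2 : ‖R (o i.succ) - t i‖ < r * δ := hnear i
          linarith [norm_sub_le_norm_sub_add_norm_sub (o i.succ) (R (o i.succ)) (t i : E)]

end Nets

/-! ### Haar measure of balls around frames -/

section OrthogonalHaar

open MeasureTheory Module

instance isProbabilityMeasure_orthogonalHaar (n : ℕ) :
    IsProbabilityMeasure (orthogonalHaar n) :=
  ⟨Measure.haarMeasure_self (K₀ := ⊤)⟩

instance isMulLeftInvariant_orthogonalHaar (n : ℕ) :
    (orthogonalHaar n).IsMulLeftInvariant :=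
  Measure.isMulLeftInvariant_haarMeasure ⊤

theorem norm_orthogonalGroup_mulVec {n : ℕ} (g : Matrix.orthogonalGroup (Fin n) ℝ)
    (x : Fin n → ℝ) :
    ‖WithLp.toLp 2 ((g : Matrix (Fin n) (Fin n) ℝ).mulVec x)‖ = ‖WithLp.toLp 2 x‖ := by
  have hsq : ∀ y : Fin n → ℝ, ‖WithLp.toLp 2 y‖ ^ 2 = y ⬝ᵥ y := fun y => by
    rw [EuclideanSpace.real_norm_sq_eq]
    simp [dotProduct, sq]
  have hg : (g : Matrix (Fin n) (Fin n) ℝ).transpose * g = 1 :=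
    (Matrix.mem_orthogonalGroup_iff' (Fin n) ℝ).mp g.2
  rw [← sq_eq_sq₀ (norm_nonneg _) (norm_nonneg _), hsq, hsq, Matrix.dotProduct_mulVec,
    ← Matrix.mulVec_transpose, Matrix.mulVec_mulVec, hg, Matrix.one_mulVec]

/-- The `i`-th column of an orthogonal matrix, as a Euclidean vector. -/
def orthogonalColumn {n r : ℕ} (hr : r ≤ n) (O : Matrix.orthogonalGroup (Fin n) ℝ) (i : Fin r) :
    EuclideanSpace ℝ (Fin n) :=
  WithLp.toLp 2 fun k => (O : Matrix (Fin n) (Fin n) ℝ) k (Fin.castLE hr i)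

theorem orthogonalColumn_mul {n r : ℕ} (hr : r ≤ n) (g O : Matrix.orthogonalGroup (Fin n) ℝ)
    (i : Fin r) :
    orthogonalColumn hr (g * O) i =
      WithLp.toLp 2 ((g : Matrix (Fin n) (Fin n) ℝ).mulVec (orthogonalColumn hr O i).ofLp) :=
  rfl

theorem orthonormal_orthogonalColumn {n r : ℕ} (hr : r ≤ n)
    (O : Matrix.orthogonalGroup (Fin n) ℝ) : Orthonormal ℝ (orthogonalColumn hr O) := by
  rw [orthonormal_iff_ite]
  intro i j
  have hO : (O : Matrix (Fin n) (Fin n) ℝ).transpose * O = 1 :=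
    (Matrix.mem_orthogonalGroup_iff' (Fin n) ℝ).mp O.2
  have h := congrFun₂ hO (Fin.castLE hr i) (Fin.castLE hr j)
  rw [Matrix.mul_apply, Matrix.one_apply] at h
  simpa [orthogonalColumn, PiLp.inner_apply, mul_comm, (Fin.castLE_injective hr).eq_iff] using h

/-- Transitivity on frames: extend `w` to an orthonormal basis and use its vectors as columns. -/
theorem exists_orthogonalColumn_eq {n r : ℕ} (hr : r ≤ n)
    {w : Fin r → EuclideanSpace ℝ (Fin n)} (hw : Orthonormal ℝ w) :
    ∃ Q : Matrix.orthogonalGroup (Fin n) ℝ, orthogonalColumn hr Q = w := by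
  let v : Fin n → EuclideanSpace ℝ (Fin n) := fun k => if h : (k : ℕ) < r then w ⟨k, h⟩ else 0
  have hv : Orthonormal ℝ (Set.domRestrict {k : Fin n | (k : ℕ) < r} v) := by
    have hfun : Set.domRestrict {k : Fin n | (k : ℕ) < r} v =
        w ∘ fun k : {k : Fin n | (k : ℕ) < r} => ⟨k.1, k.2⟩ := by
      funext k
      have hk : (k.1 : ℕ) < r := k.2
      simp [v, hk]
    rw [hfun]
    refine hw.comp _ fun a b hab => ?_
    exact Subtype.ext (Fin.ext (by simpa using hab))
  obtain ⟨b, hb⟩ := hv.exists_orthonormalBasis_extension_of_card_eq (by simp)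
  refine ⟨⟨_, (EuclideanSpace.basisFun (Fin n) ℝ).toMatrix_orthonormalBasis_mem_orthogonal b⟩, ?_⟩
  funext i
  ext k
  have h := hb (Fin.castLE hr i) (by simp)
  simp [v] at h
  simp [orthogonalColumn, Basis.toMatrix_apply, h]

/-- The orthogonal matrices whose first `r` columns are `ε`-close to `w`. -/
def columnBall {n r : ℕ} (hr : r ≤ n) (w : Fin r → EuclideanSpace ℝ (Fin n)) (ε : ℝ) :
    Set (Matrix.orthogonalGroup (Fin n) ℝ) :=
  {O | ∀ i, ‖orthogonalColumn hr O i - w i‖ < ε}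

theorem measure_columnBall_eq {n r : ℕ} (hr : r ≤ n) {w t : Fin r → EuclideanSpace ℝ (Fin n)}
    (hw : Orthonormal ℝ w) (ht : Orthonormal ℝ t) (ε : ℝ) :
    (orthogonalHaar n).real (columnBall hr t ε) = (orthogonalHaar n).real (columnBall hr w ε) := by
  obtain ⟨W, rfl⟩ := exists_orthogonalColumn_eq hr hw
  obtain ⟨T, rfl⟩ := exists_orthogonalColumn_eq hr ht
  rw [measureReal_def, measureReal_def,
    -- Left translation by `W * T⁻¹` carries the frame of `T` to that of `W` and preserves distances
    -- between columns.
    ← measure_preimage_mul (orthogonalHaar n) (W * T⁻¹) (columnBall hr (orthogonalColumn hr W) ε)]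
  congr 2
  ext O
  refine forall_congr' fun i => ?_
  have h : orthogonalColumn hr W i = orthogonalColumn hr (W * T⁻¹ * T) i := by
    rw [inv_mul_cancel_right]
  have h' : orthogonalColumn hr (W * T⁻¹ * O) i - orthogonalColumn hr W i =
      WithLp.toLp 2 (((W * T⁻¹ : Matrix.orthogonalGroup (Fin n) ℝ) :
        Matrix (Fin n) (Fin n) ℝ).mulVec (orthogonalColumn hr O i - orthogonalColumn hr T i).ofLp) := by
    rw [h, orthogonalColumn_mul, orthogonalColumn_mul, ← WithLp.toLp_sub, ← Matrix.mulVec_sub,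
      WithLp.ofLp_sub]
  rw [h', norm_orthogonalGroup_mulVec]

/-- A covering of the orthonormal frames by balls bounds the Haar measure of each ball below. -/
theorem one_le_card_mul_measure_columnBall {n r : ℕ} (hr : r ≤ n)
    {w : Fin r → EuclideanSpace ℝ (Fin n)} (hw : Orthonormal ℝ w) {ε : ℝ}
    (T : Finset (Fin r → EuclideanSpace ℝ (Fin n))) (hT : ∀ t ∈ T, Orthonormal ℝ t)
    (hcover : ∀ o : Fin r → EuclideanSpace ℝ (Fin n), Orthonormal ℝ o →
      ∃ t ∈ T, ∀ i, ‖o i - t i‖ < ε) :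
    1 ≤ (T.card : ℝ) * (orthogonalHaar n).real (columnBall hr w ε) := by
  have huniv : (⋃ t ∈ T, columnBall hr t ε) = Set.univ := by
    refine Set.eq_univ_of_forall fun O => ?_
    obtain ⟨t, ht, h⟩ := hcover _ (orthonormal_orthogonalColumn hr O)
    exact Set.mem_biUnion ht h
  calc (1 : ℝ) = (orthogonalHaar n).real (⋃ t ∈ T, columnBall hr t ε) := by
        rw [huniv, probReal_univ]
    _ ≤ ∑ t ∈ T, (orthogonalHaar n).real (columnBall hr t ε) := measureReal_biUnion_finset_le _ _
    _ = ∑ t ∈ T, (orthogonalHaar n).real (columnBall hr w ε) :=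
        Finset.sum_congr rfl fun t ht => measure_columnBall_eq hr hw (hT t ht) ε
    _ = (T.card : ℝ) * (orthogonalHaar n).real (columnBall hr w ε) := by simp

end OrthogonalHaar

/-! ### Passage from real vectors of `ℂ^d ⊗ ℂ^d` to `ℝ^(d²)` -/

section RealCoordinates

open Module

/-- The canonical basis of `ℂ^d ⊗ ℂ^d`, enumerated lexicographically. -/
noncomputable def lexBasis (d : ℕ) : OrthonormalBasis (Fin (d * d)) ℂ (TwoQudit d) :=
  (canonicalBasis d).reindex finProdFinEquiv

/-- The real parts of the coordinates in the canonical basis. -/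
noncomputable def realCoordinates {d : ℕ} (x : TwoQudit d) : EuclideanSpace ℝ (Fin (d * d)) :=
  WithLp.toLp 2 fun k => ((lexBasis d).repr x k).re

theorem HasRealCoefficients.repr_eq {d : ℕ} {x : TwoQudit d} (hx : HasRealCoefficients x)
    (k : Fin (d * d)) : (lexBasis d).repr x k = (realCoordinates x k : ℂ) := by
  refine Complex.ext rfl ?_
  simpa [lexBasis, OrthonormalBasis.repr_reindex] using hx (finProdFinEquiv.symm k)

theorem orthonormal_realCoordinates {d r : ℕ} {v : Fin r → TwoQudit d} (hv : Orthonormal ℂ v)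
    (hreal : ∀ i, HasRealCoefficients (v i)) : Orthonormal ℝ fun i => realCoordinates (v i) := by
  rw [orthonormal_iff_ite] at hv ⊢
  intro i j
  have h := hv i j
  rw [← (lexBasis d).repr.inner_map_map, PiLp.inner_apply] at h
  simp only [(hreal _).repr_eq] at h
  rw [PiLp.inner_apply]
  apply Complex.ofReal_injective
  rw [apply_ite Complex.ofReal]
  simpa using h

theorem repr_columnFamily {d r : ℕ} (hr : r ≤ d * d)
    (O : Matrix.orthogonalGroup (Fin (d * d)) ℝ) (i : Fin r) (k : Fin (d * d)) :
    (lexBasis d).repr (columnFamily hr O i) k = (orthogonalColumn hr O i k : ℂ) := by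
  have h : columnFamily hr O i = ∑ k, (orthogonalColumn hr O i k : ℂ) • lexBasis d k := by
    rw [← finProdFinEquiv.sum_comp]
    simp [columnFamily, orthogonalColumn, lexBasis]
  rw [h, OrthonormalBasis.repr_apply_apply, (lexBasis d).orthonormal.inner_right_fintype]

theorem norm_columnFamily_sub {d r : ℕ} (hr : r ≤ d * d)
    (O : Matrix.orthogonalGroup (Fin (d * d)) ℝ) (i : Fin r) {x : TwoQudit d}
    (hx : HasRealCoefficients x) :
    ‖columnFamily hr O i - x‖ = ‖orthogonalColumn hr O i - realCoordinates x‖ := by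
  rw [← (lexBasis d).repr.norm_map, map_sub, EuclideanSpace.norm_eq, EuclideanSpace.norm_eq]
  congr 1
  refine Finset.sum_congr rfl fun k _ => ?_
  rw [PiLp.sub_apply, PiLp.sub_apply, repr_columnFamily, hx.repr_eq, ← Complex.ofReal_sub,
    Complex.norm_real]

end RealCoordinates

/-! ### Exponent count and conclusion -/

theorem sum_range_sub_eq_mul_sub_choose {n : ℕ} (r : ℕ) (hr : r ≤ n) :
    ∑ i ∈ Finset.range r, (n - 1 - i) = r * n - (r + 1).choose 2 := by
  have h : ∀ r ≤ n, ∑ i ∈ Finset.range r, (n - 1 - i) + (r + 1).choose 2 = r * n := by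
    intro r
    induction r with
    | zero => simp
    | succ r ih =>
      intro hr
      have h1 := ih (by omega)
      rw [Finset.sum_range_succ, Nat.choose_succ_succ' (r + 1) 1, Nat.choose_one_right, one_add_one_eq_two,
        add_mul]
      omega
  have := h r hr
  omega

theorem mainTheorem5 (d r : ℕ) (hd : 2 ≤ d) (hr : 1 ≤ r) (hrd : r ≤ d * d)
    (ε : ℝ) (hε : 0 < ε) (hε' : ε < 1 / 4)
    (v : Fin r → TwoQudit d) (hv : Orthonormal ℂ v) (hreal : ∀ i, HasRealCoefficients (v i)) :
    (2 * (d : ℝ) * √Real.pi)⁻¹ ^ r *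
        ((ε / 8) / (4 ^ r * √(r.factorial : ℝ))) ^ (r * d ^ 2 - (r + 1).choose 2) <
      (orthogonalHaar (d * d)).real
        {O | (⨆ i : Fin r, ‖columnFamily hrd O i - v i‖) < ε} := by
  have hr1 : (1 : ℝ) ≤ r := by exact_mod_cast hr
  have hd2 : (2 : ℝ) ≤ d := by exact_mod_cast hd
  have hr0 : (0 : ℝ) < r := by linarith
  have hset : {O | (⨆ i : Fin r, ‖columnFamily hrd O i - v i‖) < ε} =
      columnBall hrd (fun i => realCoordinates (v i)) ε := by
    have : Nonempty (Fin r) := ⟨⟨0, hr⟩⟩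
    ext O
    simp only [columnBall, Set.mem_ofPred_eq, norm_columnFamily_sub hrd O _ (hreal _)]
    constructor
    · exact fun h i => (le_ciSup (Set.finite_range _).bddAbove i).trans_lt h
    · intro h
      obtain ⟨i, hi⟩ := exists_eq_ciSup_of_finite
        (f := fun i => ‖orthogonalColumn hrd O i - realCoordinates (v i)‖)
      exact hi ▸ h i
  rw [hset]
  -- The mesh `ε / r` makes the accumulated error `r * δ` equal to `ε`.
  have hδ1 : ε / r ≤ 1 := by rw [div_le_one hr0]; linarith
  obtain ⟨T, hT, hcard, hcover⟩ := exists_orthonormal_net (div_pos hε hr0) hδ1 r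
    (E := EuclideanSpace ℝ (Fin (d * d))) finrank_euclideanSpace_fin hrd
  rw [mul_div_cancel₀ ε hr0.ne'] at hcover
  have hone := one_le_card_mul_measure_columnBall hrd (orthonormal_realCoordinates hv hreal)
    T hT hcover
  rw [Finset.prod_mul_distrib, Finset.prod_const, Finset.card_range, Finset.prod_pow_eq_pow_sum,
    sum_range_sub_eq_mul_sub_choose r hrd] at hcard
  rw [sq d]
  set m := (orthogonalHaar (d * d)).real (columnBall hrd (fun i => realCoordinates (v i)) ε)
  set e := r * (d * d) - (r + 1).choose 2
  have hm : (2⁻¹ : ℝ) ^ r * (ε / (6 * r)) ^ e ≤ m := by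
    have h1 : 1 ≤ 2 ^ r * (6 / (ε / r)) ^ e * m :=
      hone.trans (mul_le_mul_of_nonneg_right hcard MeasureTheory.measureReal_nonneg)
    have h2 : (2⁻¹ : ℝ) ^ r * (ε / (6 * r)) ^ e = (2 ^ r * (6 / (ε / r)) ^ e)⁻¹ := by
      rw [mul_inv, ← inv_pow, ← inv_pow]; congr 2; field_simp
    rw [h2]
    exact (inv_le_iff_one_le_mul₀' (by positivity)).mpr h1
  have hfact : (1 : ℝ) ≤ √(r.factorial : ℝ) :=
    Real.one_le_sqrt.mpr (by exact_mod_cast r.factorial_pos)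
  have hpow : (r : ℝ) ≤ 4 ^ r := by exact_mod_cast (Nat.lt_pow_self (by norm_num)).le
  have hbase : (ε / 8) / (4 ^ r * √(r.factorial : ℝ)) ≤ ε / (6 * r) := by
    rw [div_div]
    gcongr
    · norm_num
    · nlinarith
  have hpi : 1 ≤ √Real.pi := Real.one_le_sqrt.mpr (by linarith [Real.pi_gt_three])
  -- The strict inequality of the theorem comes from here, together with `r ≥ 1`.
  have hconst : (2 * (d : ℝ) * √Real.pi)⁻¹ < 2⁻¹ := by
    gcongr
    nlinarith
  calc _ < (2⁻¹ : ℝ) ^ r * ((ε / 8) / (4 ^ r * √(r.factorial : ℝ))) ^ e := by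
        gcongr
    _ ≤ 2⁻¹ ^ r * (ε / (6 * r)) ^ e := by gcongr
    _ ≤ m := hm
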